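/- Let $X$ be a real or complex Banach space. Notation: $B_X$ is the closed unit ball of $X$; an operator is a bounded linear map between Banach spaces over the same scalar field, and $T^*$ is its adjoint. For a subset $A$ of a Banach space $Z$ put $$\omega(A)=\inf\Big\{\sup_{a\in A}\operatorname{dist}(a,K):\ \emptyset\ne K\subset Z\ \text{weakly compact}\Big\}$$ (the de Blasi measure of weak non-compactness), and for an operator $T:Y\to Z$ put $\omega(T)=\omega(T(B_Y))$. For a bounded set $F\subset Z^*$ put $q_F(z)=\sup_{f\in F}|f(z)|$ (with $\sup\emptyset=0$). For a family $\mathcal F$ of subsets of $B_{Z^*}$ and a bounded sequence $(z_n)$ in $Z$ put $$\mathrm{ca}_{\mathcal F}(z_n)=\sup_{F\in\mathcal F}\ \inf_{N}\ \sup_{m,n\ge N} q_F(z_m-z_n),\qquad \widetilde{\mathrm{ca}}_{\mathcal F}(z_n)=\inf\{\mathrm{ca}_{\mathcal F}(z_{n_k}): (z_{n_k})\text{ a subsequence of }(z_n)\}.$$ Write $\mathrm{ca}$ for $\mathrm{ca}_{\mathcal F}$ when $\mathcal F$ consists of all subsets of $B_{Z^*}$ (the norm topology), and $\widetilde{\mathrm{ca}}_{\rho}$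 for $\widetilde{\mathrm{ca}}_{\mathcal F}$ when $\mathcal F$ consists of all weakly compact subsets of $B_{Z^*}$. On a dual space $Z=X^*$, write $\widetilde{\mathrm{ca}}_{\rho^*}$ for $\widetilde{\mathrm{ca}}_{\mathcal F}$ when $\mathcal F$ consists of all weakly compact subsets of $B_X$, canonically embedded in $B_{X^{**}}$. For an operator $T:Y\to Z$ put $$\mathrm{cc}(T)=\sup\{\mathrm{ca}(Ty_k): (y_k)\text{ a weakly Cauchy sequence in }B_Y\}.$$ An operator $T:Y\to Z$ is weakly compact if $T(B_Y)$ is relatively weakly compact in $Z$, and completely continuous if it maps weakly convergent sequences to norm convergent ones. $X$ has the Dunford–Pettis property if, for every Banach space $Y$, every weakly compact operator $T:X\to Y$ is completely continuous. **Theorem.** The following assertions are equivalent: (i) $X$ has the Dunford–Pettis property; (ii) $\mathrm{cc}(T)\le 2\,\omega(T^*)$ for every operator $T$ from $X$ to any Banach space $Y$; (iii) $\mathrm{cc}(T^*)\le 2\,\omega(T)$ for every operator $T$ from any Banach space $Y$ to $X$; (iv) $\limsup_n|x_n^*(x_n)|\le\omega(\{x_n^*:n\in\mathbb N\})$ whenever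 $(x_n)$ is a weakly null sequence in $B_X$ and $(x_n^*)$ is a bounded sequence in $X^*$; (v) $\limsup_n|x_n^*(x_n)|\le\omega(\{x_n:n\in\mathbb N\})$ whenever $(x_n)$ is a bounded sequence in $X$ and $(x_n^*)$ is a weakly null sequence in $B_{X^*}$; (vi) $\widetilde{\mathrm{ca}}_{\rho^*}(x_n^*)\le 2\,\omega(\{x_n^*:n\in\mathbb N\})$ whenever $(x_n^*)$ is a bounded sequence in $X^*$; (vii) $\widetilde{\mathrm{ca}}_{\rho}(x_n)\le 2\,\omega(\{x_n:n\in\mathbb N\})$ whenever $(x_n)$ is a bounded sequence in $X$. -/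

import Mathlib

open Set Filter Topology
open scoped ENNReal

universe u v w

noncomputable section

namespace QuantDP

section Basic

variable (𝕜 : Type*) [RCLike 𝕜] {X : Type*} [NormedAddCommGroup X] [NormedSpace 𝕜 X]

/-- A set is weakly compact if it is compact in the weak topology `σ(X, X*)`. -/
def IsWeaklyCompact (K : Set X) : Prop :=
  IsCompact (toWeakSpace 𝕜 X '' K)

/-- A set is relatively weakly compact if its weak closure is weakly compact. -/
def IsRelWeaklyCompact (A : Set X) : Prop :=
  IsCompact (closure (toWeakSpace 𝕜 X '' A))

/-- Weak convergence of a sequence. -/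
def WeaklyTendsto (x : ℕ → X) (a : X) : Prop :=
  Tendsto (fun n => toWeakSpace 𝕜 X (x n)) atTop (𝓝 (toWeakSpace 𝕜 X a))

/-- The seminorm `q_F(x) = sup {|f x| : f ∈ F}`, with values in `[0, ∞]`. -/
def qSeminorm {𝕜 : Type*} [RCLike 𝕜] {X : Type*} [NormedAddCommGroup X] [NormedSpace 𝕜 X]
    (F : Set (StrongDual 𝕜 X)) (x : X) : ℝ≥0∞ :=
  ⨆ f ∈ F, ‖f x‖ₑ

/-- All subsets of the dual unit ball; the associated topology is the norm topology. -/
def normFamily (X : Type*) [NormedAddCommGroup X] [NormedSpace 𝕜 X] :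
    Set (Set (StrongDual 𝕜 X)) :=
  {F | F ⊆ Metric.closedBall 0 1}

/-- Finite subsets of the dual unit ball; the associated topology is the weak topology. -/
def weakFamily (X : Type*) [NormedAddCommGroup X] [NormedSpace 𝕜 X] :
    Set (Set (StrongDual 𝕜 X)) :=
  {F | F ⊆ Metric.closedBall 0 1 ∧ F.Finite}

/-- Weakly compact subsets of the dual unit ball (compact for `σ(X*, X**)`); the associated
topology on `X` is the Right topology `ρ`. -/
def rhoFamily (X : Type*) [NormedAddCommGroup X] [NormedSpace 𝕜 X] :
    Set (Set (StrongDual 𝕜 X)) :=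
  {F | F ⊆ Metric.closedBall 0 1 ∧ IsWeaklyCompact 𝕜 F}

/-- Weakly compact subsets of the unit ball of `X`, embedded canonically in `X**`; the associated
topology on `X*` is the Mackey topology `ρ*` of the pair `(X*, X)`. -/
def rhoStarFamily (X : Type*) [NormedAddCommGroup X] [NormedSpace 𝕜 X] :
    Set (Set (StrongDual 𝕜 (StrongDual 𝕜 X))) :=
  {F | ∃ L : Set X, L ⊆ Metric.closedBall 0 1 ∧ IsWeaklyCompact 𝕜 L ∧
    F = NormedSpace.inclusionInDoubleDual 𝕜 X '' L}

/-- The de Blasi measure of weak non-compactness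
`ω(A) = inf {d̂(A, K) : K nonempty and weakly compact}`, `d̂(A, K) = sup_{a ∈ A} d(a, K)`. -/
def deBlasi (A : Set X) : ℝ≥0∞ :=
  ⨅ K : {K : Set X // K.Nonempty ∧ IsWeaklyCompact 𝕜 K}, ⨆ a ∈ A, Metric.infEDist a K.1

end Basic

section Families

variable {𝕜 : Type*} [RCLike 𝕜] {X : Type*} [NormedAddCommGroup X] [NormedSpace 𝕜 X]

/-- The quantity `ca_𝓕`, measuring how far a sequence is from being Cauchy for the topology of
uniform convergence on the members of `𝓕`. -/
def ca (𝓕 : Set (Set (StrongDual 𝕜 X))) (x : ℕ → X) : ℝ≥0∞ :=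
  ⨆ F ∈ 𝓕, ⨅ N : ℕ, ⨆ m ≥ N, ⨆ n ≥ N, qSeminorm F (x m - x n)

/-- The infimum of `ca_𝓕` over all subsequences. -/
def wca (𝓕 : Set (Set (StrongDual 𝕜 X))) (x : ℕ → X) : ℝ≥0∞ :=
  ⨅ φ : {φ : ℕ → ℕ // StrictMono φ}, ca 𝓕 (x ∘ φ.1)

/-- Cauchy sequences for the topology generated by the seminorms `q_F`, `F ∈ 𝓕`. -/
def IsCauchyFor (𝓕 : Set (Set (StrongDual 𝕜 X))) (x : ℕ → X) : Prop :=
  ∀ F ∈ 𝓕, ∀ ε : ℝ≥0∞, 0 < ε → ∃ N : ℕ, ∀ m ≥ N, ∀ n ≥ N, qSeminorm F (x m - x n) < ε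

end Families

section Operators

variable {𝕜 : Type*} [RCLike 𝕜] {X : Type*} [NormedAddCommGroup X] [NormedSpace 𝕜 X]
  {Y : Type*} [NormedAddCommGroup Y] [NormedSpace 𝕜 Y]

/-- The Banach-space adjoint `T* : Y* → X*`, `T* g = g ∘ T`. -/
def adj (T : X →L[𝕜] Y) : StrongDual 𝕜 Y →L[𝕜] StrongDual 𝕜 X :=
  ContinuousLinearMap.precomp 𝕜 T

/-- `ω(T) = ω(T(B_X))`. -/
def opDeBlasi (T : X →L[𝕜] Y) : ℝ≥0∞ :=
  deBlasi 𝕜 (T '' Metric.closedBall 0 1)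

/-- `cc(T)`: the supremum of `ca (T x_k)` (norm topology) over weakly Cauchy sequences `(x_k)` in
the unit ball. -/
def cc (T : X →L[𝕜] Y) : ℝ≥0∞ :=
  ⨆ x : {x : ℕ → X // (∀ k, x k ∈ Metric.closedBall (0 : X) 1) ∧ IsCauchyFor (weakFamily 𝕜 X) x},
    ca (normFamily 𝕜 Y) (fun k => T (x.1 k))

/-- Weakly compact operators. -/
def IsWeaklyCompactOp (T : X →L[𝕜] Y) : Prop :=
  IsRelWeaklyCompact 𝕜 (T '' Metric.closedBall 0 1)

/-- Completely continuous operators: weakly convergent sequences are mapped to norm convergent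
ones (the norm limit is necessarily the image of the weak limit). -/
def IsCompletelyContinuous (T : X →L[𝕜] Y) : Prop :=
  ∀ (x : ℕ → X) (a : X), WeaklyTendsto 𝕜 x a → Tendsto (fun n => T (x n)) atTop (𝓝 (T a))

end Operators

/-- The Dunford–Pettis property: every weakly compact operator from `X` to any Banach space is
completely continuous. -/
def HasDPP (𝕜 : Type w) [RCLike 𝕜] (X : Type u) [NormedAddCommGroup X] [NormedSpace 𝕜 X] :
    Prop :=
  ∀ (Y : Type v) [NormedAddCommGroup Y] [NormedSpace 𝕜 Y] [CompleteSpace Y] (T : X →L[𝕜] Y),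
    IsWeaklyCompactOp T → IsCompletelyContinuous T

end QuantDP

end

/-!
All seven assertions are equivalent to the sequential form of the Dunford–Pettis property: if `(xₙ)`
is weakly null in `X` and `(fₙ)` is weakly null in `X*`, then `fₙ(xₙ) → 0` (`SequentialDPP`). This
form is symmetric in `X` and `X*`, so its consequences are proved once, for a bilinear pairing
(`DPPairing`), and applied both to `X* × X` and to `X × X*`.

From the sequential property to the quantitative estimates: by the Eberlein–Šmulian theorem
(`IsWeaklyCompact.exists_subseq`), weakly null sequences tend to zero uniformly on weakly compact
sets of the other space (`DPPairing.eventually_forall_norm_lt`). If `A` lies within `c` of a weakly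
compact set `K`, replacing the points of `A` by points of `K` costs `c` against one vector of the
unit ball and `2c` against a difference of two such vectors, and what is left tends to zero. This
gives the constant `1` for the `limsup` estimates and the constant `2` for `cc`. For the subsequence
estimates one picks a subsequence whose approximants in `K` converge weakly.

Back to the sequential property: the range of a weakly null sequence has `ω = 0`, which settles the
assertions about sequences. For those about operators, a weakly null `(fₙ)` in `X*` gives
`x ↦ (fₙ(x))`, from `X` to `c₀`, and a weakly null `(xₙ)` in `X` gives `a ↦ ∑ aₙ xₙ`, from `ℓ¹` to
`X`; the set of sums `∑ aₙ xₙ` with `∑ |aₙ| ≤ 1` is weakly compact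
(`WeaklyTendsto.isWeaklyCompact_l1Hull`), and so is its analogue for `(fₙ)`. As target and source
spaces range over a fixed universe, isometric copies of `c₀` and `ℓ¹` in that universe are used;
they exist because these spaces have at most the cardinality of the continuum.

Finally, the passage between the definition of the Dunford–Pettis property and its sequential form
rests on Gantmacher's theorem, in the form that `T` is weakly compact if and only if `T**` takes
values in the target space, in which case `T*` maps the dual unit ball onto a weakly compact set
(`IsWeaklyCompactOp.bidualMapsInto`, `BidualMapsInto.isWeaklyCompact_adj`,
`BidualMapsInto.isWeaklyCompactOp`).
-/

namespace QuantDP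

/-! ### Weak convergence and weakly compact sets -/

section WeakTopology

variable {𝕜 : Type*} [RCLike 𝕜] {E : Type*} [NormedAddCommGroup E] [NormedSpace 𝕜 E]

theorem weaklyTendsto_iff {x : ℕ → E} {a : E} :
    WeaklyTendsto 𝕜 x a ↔ ∀ f : StrongDual 𝕜 E, Tendsto (fun n => f (x n)) atTop (𝓝 (f a)) := by
  refine (WeakBilin.tendsto_iff_forall_eval_tendsto (B := (topDualPairing 𝕜 E).flip) ?_)
  intro x y h
  refine (NormedSpace.inclusionInDoubleDualLi (E := E) 𝕜).injective ?_
  ext f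
  exact DFunLike.congr_fun h f

theorem WeaklyTendsto.comp {x : ℕ → E} {a : E} (h : WeaklyTendsto 𝕜 x a) {φ : ℕ → ℕ}
    (hφ : Tendsto φ atTop atTop) : WeaklyTendsto 𝕜 (x ∘ φ) a :=
  Tendsto.comp (g := fun n => toWeakSpace 𝕜 E (x n)) h hφ

theorem WeaklyTendsto.sub_const {x : ℕ → E} {a : E} (h : WeaklyTendsto 𝕜 x a) :
    WeaklyTendsto 𝕜 (fun n => x n - a) 0 := by
  rw [weaklyTendsto_iff] at h ⊢
  intro f
  simpa using (h f).sub_const (f a)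

theorem WeaklyTendsto.const_smul {x : ℕ → E} {a : E} (h : WeaklyTendsto 𝕜 x a) (c : 𝕜) :
    WeaklyTendsto 𝕜 (fun n => c • x n) (c • a) := by
  rw [weaklyTendsto_iff] at h ⊢
  intro f
  simpa using (h f).const_mul c

/-- Weakly convergent sequences are norm bounded (uniform boundedness principle, applied to the
sequence as a family of functionals on the dual). -/
theorem WeaklyTendsto.exists_norm_le {x : ℕ → E} {a : E} (h : WeaklyTendsto 𝕜 x a) :
    ∃ M : ℝ, 0 < M ∧ ∀ n, ‖x n‖ ≤ M := by
  rw [weaklyTendsto_iff] at h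
  obtain ⟨C, hC⟩ := banach_steinhaus (g := fun n => NormedSpace.inclusionInDoubleDual 𝕜 E (x n))
    (fun f => by
      obtain ⟨C, hC⟩ := (h f).norm.bddAbove_range
      exact ⟨C, fun n => hC ⟨n, rfl⟩⟩)
  refine ⟨max C 1, by positivity, fun n => le_trans ?_ (le_max_left _ _)⟩
  have h1 := (NormedSpace.inclusionInDoubleDualLi (E := E) 𝕜).norm_map (x n)
  rw [← h1]
  exact hC n

theorem continuous_toWeakSpace_apply (f : StrongDual 𝕜 E) :
    Continuous fun z : WeakSpace 𝕜 E => f ((toWeakSpace 𝕜 E).symm z) :=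
  WeakBilin.eval_continuous (topDualPairing 𝕜 E).flip f

/-- The terms of a weakly convergent sequence together with its limit form a weakly compact set. -/
theorem WeaklyTendsto.isWeaklyCompact {x : ℕ → E} {a : E} (h : WeaklyTendsto 𝕜 x a) :
    IsWeaklyCompact 𝕜 (insert a (range x)) := by
  have := h.isCompact_insert_range
  rw [IsWeaklyCompact, image_insert_eq, ← range_comp]
  exact this

/-- A separable part of a normed space is separated by countably many functionals. -/
theorem exists_seq_dual_separating {s : Set E} (hs : TopologicalSpace.IsSeparable s) :
    ∃ g : ℕ → StrongDual 𝕜 E, ∀ z ∈ s, (∀ i, g i z = 0) → z = 0 := by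
  obtain ⟨c, hc, hsc⟩ := hs
  rcases c.eq_empty_or_nonempty with rfl | hne
  · exact ⟨0, fun z hz => by simpa using hsc hz⟩
  obtain ⟨d, rfl⟩ := hc.exists_eq_range hne
  choose g hg1 hg2 using fun i => exists_dual_vector'' 𝕜 (d i)
  refine ⟨g, fun z hz h0 => ?_⟩
  rw [← norm_le_zero_iff]
  refine le_of_forall_pos_le_add fun ε hε => ?_
  obtain ⟨_, ⟨i, rfl⟩, hi⟩ := Metric.mem_closure_iff.1 (hsc hz) (ε / 2) (half_pos hε)
  rw [dist_eq_norm] at hi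
  have h1 : ‖d i‖ ≤ ‖z - d i‖ := by
    calc ‖d i‖ = ‖g i (d i)‖ := by rw [hg2]; simp
      _ = ‖g i (z - d i)‖ := by rw [map_sub, h0 i, zero_sub, norm_neg]
      _ ≤ ‖g i‖ * ‖z - d i‖ := (g i).le_opNorm _
      _ ≤ 1 * ‖z - d i‖ := by gcongr; exact hg1 i
      _ = _ := one_mul _
  calc ‖z‖ = ‖(z - d i) + d i‖ := by rw [sub_add_cancel]
    _ ≤ ‖z - d i‖ + ‖d i‖ := norm_add_le _ _
    _ ≤ 0 + ε := by linarith

/-- The half of the **Eberlein–Šmulian theorem** used here: weakly compact sets are weakly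
sequentially compact. On the closed span of the sequence the weak topology of a weakly compact set
is the metrizable topology given by countably many functionals. -/
theorem IsWeaklyCompact.exists_subseq {K : Set E} (hK : IsWeaklyCompact 𝕜 K) {k : ℕ → E}
    (hk : ∀ n, k n ∈ K) :
    ∃ (a : E) (φ : ℕ → ℕ), StrictMono φ ∧ WeaklyTendsto 𝕜 (k ∘ φ) a := by
  set M : Submodule 𝕜 E := (Submodule.span 𝕜 (range k)).topologicalClosure with hM
  have hkM : ∀ n, k n ∈ M := fun n =>
    Submodule.le_topologicalClosure _ (Submodule.subset_span ⟨n, rfl⟩)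
  have hsep : TopologicalSpace.IsSeparable (M : Set E) :=
    ((countable_range k).isSeparable.span (R := 𝕜)).closure
  obtain ⟨g, hg⟩ := exists_seq_dual_separating (𝕜 := 𝕜) hsep
  have hMc : IsClosed (toWeakSpace 𝕜 E '' (M : Set E)) := by
    let _ : NormedSpace ℝ E := NormedSpace.restrictScalars ℝ 𝕜 E
    have : IsScalarTower ℝ 𝕜 E := RestrictScalars.isScalarTower ℝ 𝕜 E
    have hconv : Convex ℝ (M : Set E) := (M.restrictScalars ℝ).convex
    have hcl : IsClosed (M : Set E) := Submodule.isClosed_topologicalClosure _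
    rw [← hcl.closure_eq, hconv.toWeakSpace_closure 𝕜]
    exact isClosed_closure
  set K' : Set (WeakSpace 𝕜 E) := toWeakSpace 𝕜 E '' K ∩ toWeakSpace 𝕜 E '' (M : Set E)
  have hK' : IsCompact K' := IsCompact.inter_right hK hMc
  let G : WeakSpace 𝕜 E → ℕ → 𝕜 := fun z i => g i ((toWeakSpace 𝕜 E).symm z)
  have hG : Continuous G := continuous_pi fun i => continuous_toWeakSpace_apply (g i)
  have hinj : Function.Injective fun z : K' => G z := by
    rintro ⟨_, hzK, z, hz, rfl⟩ ⟨_, hzK', z', hz', rfl⟩ h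
    have : z - z' = 0 := hg _ (M.sub_mem hz hz') fun i => by
      have h1 : g i z = g i z' := congrFun h i
      rw [map_sub, h1, sub_self]
    simp [sub_eq_zero.1 this]
  have : CompactSpace K' := isCompact_iff_compactSpace.1 hK'
  have hemb : IsClosedEmbedding fun z : K' => G z :=
    (hG.comp continuous_subtype_val).isClosedEmbedding hinj
  let y : ℕ → K' := fun n => ⟨toWeakSpace 𝕜 E (k n), ⟨k n, hk n, rfl⟩, ⟨k n, hkM n, rfl⟩⟩
  obtain ⟨_, ⟨a, rfl⟩, φ, hφ, hlim⟩ :=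
    (isCompact_range hemb.continuous).isSeqCompact (x := fun n => G (y n))
      (fun n => ⟨y n, rfl⟩)
  have h1 : Tendsto (y ∘ φ) atTop (𝓝 a) := hemb.isInducing.tendsto_nhds_iff.2 hlim
  have h2 : Tendsto (fun n => ((y (φ n) : K') : WeakSpace 𝕜 E)) atTop (𝓝 (a : WeakSpace 𝕜 E)) :=
    (continuous_subtype_val.tendsto a).comp h1
  refine ⟨(toWeakSpace 𝕜 E).symm a, φ, hφ, ?_⟩
  simpa [WeaklyTendsto, y] using h2

end WeakTopology

/-! ### The de Blasi measure -/

section DeBlasi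

variable {𝕜 : Type*} [RCLike 𝕜] {E : Type*} [NormedAddCommGroup E] [NormedSpace 𝕜 E]

/-- To bound `t` by a multiple of `ω(A)` it suffices to bound it by the same multiple of each `c`
for which some weakly compact set approximates `A` strictly better than `c`. -/
theorem le_mul_deBlasi {A : Set E} {t r : ℝ≥0∞} (hr0 : r ≠ 0) (hr : r ≠ ∞)
    (h : ∀ (K : Set E) (c' c : ℝ), IsWeaklyCompact 𝕜 K → 0 < c' → c' < c →
      (∀ a ∈ A, ∃ k ∈ K, ‖a - k‖ < c') → t ≤ r * ENNReal.ofReal c) :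
    t ≤ r * deBlasi 𝕜 A := by
  rw [mul_comm, ← ENNReal.div_le_iff hr0 hr]
  refine le_of_forall_gt_imp_ge_of_dense fun c hc => ?_
  obtain ⟨c', hc', hcc⟩ := exists_between hc
  obtain ⟨⟨K, hne, hK⟩, hKc⟩ := iInf_lt_iff.1 hc'
  rcases eq_or_ne c ∞ with rfl | hctop
  · exact le_top
  have hc'top : c' ≠ ∞ := ne_top_of_lt hcc
  rw [ENNReal.div_le_iff hr0 hr, mul_comm, ← ENNReal.ofReal_toReal hctop]
  refine h K c'.toReal c.toReal hK (ENNReal.toReal_pos (ne_bot_of_gt hc') hc'top)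
    ((ENNReal.toReal_lt_toReal hc'top hctop).2 hcc) fun a ha => ?_
  have h1 : Metric.infEDist a K < c' :=
    lt_of_le_of_lt (le_iSup₂ (f := fun a (_ : a ∈ A) => Metric.infEDist a K) a ha) hKc
  obtain ⟨k, hk, hd⟩ := Metric.infEDist_lt_iff.1 h1
  refine ⟨k, hk, ?_⟩
  rw [edist_dist] at hd
  rw [← dist_eq_norm]
  exact (ENNReal.ofReal_lt_iff_lt_toReal dist_nonneg hc'top).1 hd

theorem deBlasi_eq_zero_of_subset {A K : Set E} (hK : IsWeaklyCompact 𝕜 K) (hne : K.Nonempty)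
    (h : A ⊆ K) : deBlasi 𝕜 A = 0 := by
  refine le_antisymm ((iInf_le _ ⟨K, hne, hK⟩).trans ?_) zero_le
  refine iSup₂_le fun a ha => ?_
  rw [Metric.infEDist_zero_of_mem (h ha)]

theorem WeaklyTendsto.deBlasi_range {x : ℕ → E} {a : E} (h : WeaklyTendsto 𝕜 x a) :
    deBlasi 𝕜 (range x) = 0 :=
  deBlasi_eq_zero_of_subset h.isWeaklyCompact (insert_nonempty _ _) (subset_insert _ _)

theorem IsCauchyFor.eventually_norm_lt {x : ℕ → E} (h : IsCauchyFor (weakFamily 𝕜 E) x)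
    (f : StrongDual 𝕜 E) {ε : ℝ} (hε : 0 < ε) :
    ∃ N : ℕ, ∀ m ≥ N, ∀ n ≥ N, ‖f (x m - x n)‖ < ε := by
  set g : StrongDual 𝕜 E := ((‖f‖ + 1 : ℝ) : 𝕜)⁻¹ • f with hg
  have hpos : 0 < ‖f‖ + 1 := by positivity
  have hgn : ‖g‖ ≤ 1 := by
    rw [hg, norm_smul, norm_inv, RCLike.norm_ofReal, abs_of_pos hpos, inv_mul_le_one₀ hpos]
    linarith
  obtain ⟨N, hN⟩ := h {g} ⟨by simpa using hgn, finite_singleton g⟩ (ENNReal.ofReal (ε / (‖f‖ + 1)))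
    (by rw [ENNReal.ofReal_pos]; positivity)
  refine ⟨N, fun m hm n hn => ?_⟩
  have h1 := hN m hm n hn
  simp only [qSeminorm, mem_singleton_iff, iSup_iSup_eq_left] at h1
  rw [← ofReal_norm, ENNReal.ofReal_lt_ofReal_iff (by positivity), hg,
    smul_apply, norm_smul, norm_inv, RCLike.norm_ofReal, abs_of_pos hpos,
    inv_mul_eq_div, div_lt_div_iff_of_pos_right hpos] at h1
  exact h1

theorem WeaklyTendsto.isCauchyFor {x : ℕ → E} {a : E} (h : WeaklyTendsto 𝕜 x a) :
    IsCauchyFor (weakFamily 𝕜 E) x := by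
  rintro F ⟨-, hF⟩ ε hε
  obtain ⟨δ, hδ0, hδ⟩ := exists_between hε
  have h1 : ∀ f ∈ F, ∃ N : ℕ, ∀ m ≥ N, ∀ n ≥ N, ‖f (x m - x n)‖ₑ < δ := by
    intro f _
    have hc : CauchySeq fun n => f (x n) := (weaklyTendsto_iff.1 h f).cauchySeq
    obtain ⟨N, hN⟩ := EMetric.cauchySeq_iff.1 hc δ hδ0
    refine ⟨N, fun m hm n hn => ?_⟩
    rw [map_sub, ← edist_eq_enorm_sub]
    exact hN m hm n hn
  choose! N hN using h1
  obtain ⟨M, hM⟩ := (hF.image N).bddAbove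
  refine ⟨M, fun m hm n hn => lt_of_le_of_lt (iSup₂_le fun f hf => ?_) hδ⟩
  have hNM : N f ≤ M := hM ⟨f, hf, rfl⟩
  exact (hN f hf m (hNM.trans hm) n (hNM.trans hn)).le

end DeBlasi

/-! ### Bilinear pairings with the Dunford–Pettis property -/

section Pairing

variable {𝕜 : Type*} [RCLike 𝕜] {E : Type*} [NormedAddCommGroup E] [NormedSpace 𝕜 E]
  {F : Type*} [NormedAddCommGroup F] [NormedSpace 𝕜 F]

/-- A bilinear pairing sends pairs of weakly null sequences to null sequences. For the evaluation
pairing of `X*` and `X` this is the sequential form of the Dunford–Pettis property of `X`. Allowing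
an arbitrary pairing makes the roles of `X` and `X*` interchangeable. -/
def DPPairing (B : E →L[𝕜] F →L[𝕜] 𝕜) : Prop :=
  ∀ (e : ℕ → E) (f : ℕ → F), WeaklyTendsto 𝕜 e 0 → WeaklyTendsto 𝕜 f 0 →
    Tendsto (fun n => B (e n) (f n)) atTop (𝓝 0)

theorem DPPairing.tendsto_of_weaklyTendsto {B : E →L[𝕜] F →L[𝕜] 𝕜} (hB : DPPairing B)
    {e : ℕ → E} {a : E} {f : ℕ → F} (he : WeaklyTendsto 𝕜 e a) (hf : WeaklyTendsto 𝕜 f 0) :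
    Tendsto (fun n => B (e n) (f n)) atTop (𝓝 0) := by
  have h1 := hB _ _ he.sub_const hf
  have h2 : Tendsto (fun n => B a (f n)) atTop (𝓝 0) := by
    simpa using weaklyTendsto_iff.1 hf (B a)
  simpa using h1.add h2

/-- Under the Dunford–Pettis property weakly null sequences converge to zero uniformly on weakly
compact sets. -/
theorem DPPairing.eventually_forall_norm_lt {B : E →L[𝕜] F →L[𝕜] 𝕜} (hB : DPPairing B)
    {K : Set E} (hK : IsWeaklyCompact 𝕜 K) {f : ℕ → F} (hf : WeaklyTendsto 𝕜 f 0)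
    {ε : ℝ} (hε : 0 < ε) : ∀ᶠ n in atTop, ∀ k ∈ K, ‖B k (f n)‖ < ε := by
  by_contra h
  obtain ⟨ψ, hψ, hψ'⟩ := extraction_of_frequently_atTop (not_eventually.1 h)
  push Not at hψ'
  choose k hk hkε using hψ'
  obtain ⟨a, φ, hφ, hlim⟩ := hK.exists_subseq hk
  have h1 := hB.tendsto_of_weaklyTendsto hlim (hf.comp (hψ.comp hφ).tendsto_atTop)
  rw [tendsto_zero_iff_norm_tendsto_zero] at h1
  obtain ⟨n, hn⟩ := (h1.eventually_lt_const hε).exists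
  exact absurd hn (not_lt.2 (hkε (φ n)))

/-- Under the Dunford–Pettis property weakly Cauchy sequences are uniformly Cauchy on weakly compact
sets: differences along two index sequences tending to infinity are weakly null. -/
theorem DPPairing.exists_forall_norm_sub_lt {B : E →L[𝕜] F →L[𝕜] 𝕜} (hB : DPPairing B)
    {K : Set E} (hK : IsWeaklyCompact 𝕜 K) {f : ℕ → F} (hf : IsCauchyFor (weakFamily 𝕜 F) f)
    {ε : ℝ} (hε : 0 < ε) :
    ∃ N : ℕ, ∀ m ≥ N, ∀ n ≥ N, ∀ k ∈ K, ‖B k (f m - f n)‖ < ε := by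
  by_contra! h
  choose m hm n hn h using h
  have hnull : WeaklyTendsto 𝕜 (fun j => f (m j) - f (n j)) 0 := by
    rw [weaklyTendsto_iff]
    intro g
    rw [map_zero, Metric.tendsto_atTop]
    intro δ hδ
    obtain ⟨N, hN⟩ := hf.eventually_norm_lt g hδ
    exact ⟨N, fun j hj => by
      simpa [dist_eq_norm] using hN _ (hj.trans (hm j)) _ (hj.trans (hn j))⟩
  obtain ⟨j, hj⟩ := (hB.eventually_forall_norm_lt hK hnull hε).exists
  obtain ⟨k, hk, hkε⟩ := h j
  exact absurd (hj k hk) (not_lt.2 hkε)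

theorem DPPairing.limsup_le_deBlasi {B : E →L[𝕜] F →L[𝕜] 𝕜} (hB : DPPairing B)
    (hB1 : ∀ e f, ‖B e f‖ ≤ ‖e‖ * ‖f‖) (e : ℕ → E) {f : ℕ → F} (hf : WeaklyTendsto 𝕜 f 0)
    (hf1 : ∀ n, ‖f n‖ ≤ 1) :
    limsup (fun n => ‖B (e n) (f n)‖ₑ) atTop ≤ deBlasi 𝕜 (range e) := by
  rw [← one_mul (deBlasi 𝕜 (range e))]
  refine le_mul_deBlasi one_ne_zero ENNReal.one_ne_top fun K c' c hK h0 hc hA => ?_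
  rw [one_mul]
  choose k hk hd using fun n => hA (e n) ⟨n, rfl⟩
  refine limsup_le_of_le (by isBoundedDefault) ?_
  filter_upwards [hB.eventually_forall_norm_lt hK hf (sub_pos.2 hc)] with n hn
  rw [← ofReal_norm]
  refine ENNReal.ofReal_le_ofReal ?_
  calc ‖B (e n) (f n)‖ = ‖B (e n - k n) (f n) + B (k n) (f n)‖ := by simp
    _ ≤ ‖B (e n - k n) (f n)‖ + ‖B (k n) (f n)‖ := norm_add_le _ _
    _ ≤ c' * 1 + (c - c') := by
      gcongr
      · exact (hB1 _ _).trans (by gcongr; exacts [(hd n).le, hf1 n])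
      · exact (hn _ (hk n)).le
    _ = c := by ring

/-- If `A` is approximated up to `c'` by a weakly compact set, then along weakly Cauchy sequences in
the unit ball the oscillation, uniformly over `A`, is eventually at most `2 c` for `c > c'`. -/
theorem DPPairing.exists_forall_norm_sub_le {B : E →L[𝕜] F →L[𝕜] 𝕜} (hB : DPPairing B)
    (hB1 : ∀ e f, ‖B e f‖ ≤ ‖e‖ * ‖f‖) {A K : Set E} {c' c : ℝ} (hK : IsWeaklyCompact 𝕜 K)
    (h0 : 0 < c') (hc : c' < c) (hA : ∀ a ∈ A, ∃ k ∈ K, ‖a - k‖ < c') {f : ℕ → F}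
    (hf : IsCauchyFor (weakFamily 𝕜 F) f) (hf1 : ∀ n, ‖f n‖ ≤ 1) :
    ∃ N : ℕ, ∀ m ≥ N, ∀ n ≥ N, ∀ a ∈ A, ‖B a (f m - f n)‖ ≤ 2 * c := by
  obtain ⟨N, hN⟩ := hB.exists_forall_norm_sub_lt hK hf (sub_pos.2 hc)
  refine ⟨N, fun m hm n hn a ha => ?_⟩
  obtain ⟨k, hk, hd⟩ := hA a ha
  calc ‖B a (f m - f n)‖ = ‖B (a - k) (f m - f n) + B k (f m - f n)‖ := by
        rw [map_sub B a k, sub_apply, sub_add_cancel]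
    _ ≤ ‖B (a - k) (f m - f n)‖ + ‖B k (f m - f n)‖ := norm_add_le _ _
    _ ≤ c' * (1 + 1) + (c - c') := by
      gcongr
      · refine (hB1 _ _).trans ?_
        gcongr
        exact (norm_sub_le _ _).trans (add_le_add (hf1 m) (hf1 n))
      · exact (hN m hm n hn k hk).le
    _ ≤ 2 * c := by linarith

/-- A sequence approximated up to `c'` by a weakly compact set has a subsequence whose oscillation,
uniformly over any weakly compact subset of the unit ball, is eventually at most `2 c`: pick the
subsequence so that the approximants converge weakly. -/
theorem DPPairing.exists_subseq_forall_norm_sub_le {B : E →L[𝕜] F →L[𝕜] 𝕜} (hB : DPPairing B)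
    (hB1 : ∀ e f, ‖B e f‖ ≤ ‖e‖ * ‖f‖) {e : ℕ → E} {K : Set E} {c' c : ℝ}
    (hK : IsWeaklyCompact 𝕜 K) (h0 : 0 < c') (hc : c' < c)
    (hA : ∀ a ∈ range e, ∃ k ∈ K, ‖a - k‖ < c') :
    ∃ φ : ℕ → ℕ, StrictMono φ ∧ ∀ L : Set F, L ⊆ Metric.closedBall 0 1 → IsWeaklyCompact 𝕜 L →
      ∃ N : ℕ, ∀ m ≥ N, ∀ n ≥ N, ∀ l ∈ L, ‖B (e (φ m) - e (φ n)) l‖ ≤ 2 * c := by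
  choose k hk hd using fun n => hA (e n) ⟨n, rfl⟩
  obtain ⟨a, φ, hφ, hlim⟩ := hK.exists_subseq hk
  refine ⟨φ, hφ, fun L hL1 hL => ?_⟩
  have hB' : DPPairing B.flip := fun f e hf he => hB e f he hf
  obtain ⟨N, hN⟩ := eventually_atTop.1
    (hB'.eventually_forall_norm_lt hL hlim.sub_const (sub_pos.2 hc))
  have key : ∀ m ≥ N, ∀ l ∈ L, ‖B (e (φ m) - a) l‖ ≤ c := by
    intro m hm l hl
    have h1 : ‖B (k (φ m) - a) l‖ < c - c' := hN m hm l hl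
    have hl1 : ‖l‖ ≤ 1 := by simpa using hL1 hl
    calc ‖B (e (φ m) - a) l‖ = ‖B (e (φ m) - k (φ m)) l + B (k (φ m) - a) l‖ := by
          rw [← add_apply, ← map_add, sub_add_sub_cancel]
      _ ≤ ‖B (e (φ m) - k (φ m)) l‖ + ‖B (k (φ m) - a) l‖ := norm_add_le _ _
      _ ≤ c' * 1 + (c - c') := by
        gcongr
        exact (hB1 _ _).trans (by gcongr; exact (hd _).le)
      _ = c := by ring
  refine ⟨N, fun m hm n hn l hl => ?_⟩
  calc ‖B (e (φ m) - e (φ n)) l‖ = ‖B (e (φ m) - a) l - B (e (φ n) - a) l‖ := by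
        rw [← sub_apply, ← map_sub, sub_sub_sub_cancel_right]
    _ ≤ ‖B (e (φ m) - a) l‖ + ‖B (e (φ n) - a) l‖ := norm_sub_le _ _
    _ ≤ 2 * c := by linarith [key m hm l hl, key n hn l hl]

/-- It is enough to test the Dunford–Pettis pairing on weakly null sequences one of which lies in
the unit ball. -/
theorem DPPairing.of_norm_le_one {B : E →L[𝕜] F →L[𝕜] 𝕜}
    (h : ∀ (e : ℕ → E) (f : ℕ → F), WeaklyTendsto 𝕜 e 0 → WeaklyTendsto 𝕜 f 0 →
      (∀ n, ‖f n‖ ≤ 1) → Tendsto (fun n => B (e n) (f n)) atTop (𝓝 0)) : DPPairing B := by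
  intro e f he hf
  obtain ⟨M, hM, hfM⟩ := hf.exists_norm_le
  have h1 := h e (fun n => ((M : ℝ) : 𝕜)⁻¹ • f n) he
    (by simpa using hf.const_smul ((M : ℝ) : 𝕜)⁻¹) fun n => by
      rw [norm_smul, norm_inv, RCLike.norm_ofReal, abs_of_pos hM, inv_mul_le_one₀ hM]
      exact hfM n
  have hM' : ((M : ℝ) : 𝕜) ≠ 0 := by exact_mod_cast hM.ne'
  have h2 := h1.const_mul ((M : ℝ) : 𝕜)
  simpa [hM'] using h2

/-- A converse: it suffices that every weakly null sequence has subsequences that oscillate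
little, uniformly over a given weakly compact set. -/
theorem DPPairing.of_exists_subseq {B : E →L[𝕜] F →L[𝕜] 𝕜}
    (h : ∀ (e : ℕ → E) (ε : ℝ), WeaklyTendsto 𝕜 e 0 → 0 < ε →
      ∃ φ : ℕ → ℕ, StrictMono φ ∧ ∀ L : Set F, L ⊆ Metric.closedBall 0 1 → IsWeaklyCompact 𝕜 L →
      ∃ N : ℕ, ∀ m ≥ N, ∀ n ≥ N, ∀ l ∈ L, ‖B (e (φ m) - e (φ n)) l‖ ≤ ε) :
    DPPairing B := by
  refine DPPairing.of_norm_le_one fun e f he hf hf1 => ?_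
  by_contra hcon
  rw [Metric.tendsto_nhds] at hcon
  push Not at hcon
  obtain ⟨ε, hε, hfr⟩ := hcon
  obtain ⟨ψ, hψ, hψ'⟩ := extraction_of_frequently_atTop hfr
  obtain ⟨φ, hφ, hL⟩ := h (e ∘ ψ) (ε / 2) (he.comp hψ.tendsto_atTop) (half_pos hε)
  obtain ⟨N, hN⟩ := hL (insert 0 (range f)) (by
    rintro _ (rfl | ⟨n, rfl⟩)
    · simp
    · simpa using hf1 n) hf.isWeaklyCompact
  have h1 : Tendsto (fun m => ‖B (e (ψ (φ m)) - e (ψ (φ N))) (f (ψ (φ N)))‖) atTop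
      (𝓝 ‖B (0 - e (ψ (φ N))) (f (ψ (φ N)))‖) := by
    have := weaklyTendsto_iff.1 (he.comp (hψ.comp hφ).tendsto_atTop) (B.flip (f (ψ (φ N))))
    simpa using (this.sub_const (B (e (ψ (φ N))) (f (ψ (φ N))))).norm
  have h2 := le_of_tendsto h1 (eventually_atTop.2 ⟨N, fun m hm =>
    hN m hm N le_rfl _ (Or.inr ⟨ψ (φ N), rfl⟩)⟩)
  have h3 := hψ' (φ N)
  rw [dist_zero_right] at h3
  rw [zero_sub, map_neg, neg_apply, norm_neg] at h2
  linarith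

end Pairing

/-! ### Weakly compact operators and their adjoints -/

section Gantmacher

variable {𝕜 : Type*} [RCLike 𝕜] {X : Type*} [NormedAddCommGroup X] [NormedSpace 𝕜 X]
  {Y : Type*} [NormedAddCommGroup Y] [NormedSpace 𝕜 Y]

/-- The Hahn–Banach separation theorem in a locally convex space over `𝕜`, with convexity phrased
through the scalars of `𝕜`, so that no real structure has to be fixed. -/
theorem exists_re_lt_of_notMem_closure {W ι : Type*} [AddCommGroup W] [Module 𝕜 W]
    [TopologicalSpace W] [IsTopologicalAddGroup W] [ContinuousSMul 𝕜 W] {p : SeminormFamily 𝕜 W ι}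
    (hp : WithSeminorms p) {s : Set W}
    (hs : ∀ a ∈ s, ∀ b ∈ s, ∀ r t : ℝ, 0 ≤ r → 0 ≤ t → r + t = 1 →
      (r : 𝕜) • a + (t : 𝕜) • b ∈ s) {x : W} (hx : x ∉ closure s) :
    ∃ (f : StrongDual 𝕜 W) (u : ℝ), (∀ a ∈ s, RCLike.re (f a) < u) ∧ u < RCLike.re (f x) := by
  let _ : Module ℝ W := Module.compHom W (algebraMap ℝ 𝕜)
  have : IsScalarTower ℝ 𝕜 W := ⟨fun r c w => by
    rw [Algebra.smul_def, mul_smul]; rfl⟩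
  have : ContinuousSMul ℝ W := IsScalarTower.continuousSMul 𝕜
  have : LocallyConvexSpace ℝ W := hp.toLocallyConvexSpace
  have hconv : Convex ℝ s := fun a ha b hb r t hr ht hrt => hs a ha b hb r t hr ht hrt
  obtain ⟨f, u, h1, h2⟩ :=
    RCLike.geometric_hahn_banach_closed_point (𝕜 := 𝕜) hconv.closure isClosed_closure hx
  exact ⟨f, u, fun a ha => h1 a (subset_closure ha), h2⟩

/-- A point outside the weak-star closure of a convex set is separated from it by an evaluation,
since evaluations are the only weak-star continuous functionals. -/
theorem exists_re_apply_lt_of_notMem_closure_weakDual {s : Set (WeakDual 𝕜 X)}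
    (hs : ∀ a ∈ s, ∀ b ∈ s, ∀ r t : ℝ, 0 ≤ r → 0 ≤ t → r + t = 1 →
      (r : 𝕜) • a + (t : 𝕜) • b ∈ s) {p : WeakDual 𝕜 X} (hp : p ∉ closure s) :
    ∃ (x : X) (u : ℝ), (∀ a ∈ s, RCLike.re (a x) < u) ∧ u < RCLike.re (p x) := by
  obtain ⟨φ, u, h1, h2⟩ :=
    exists_re_lt_of_notMem_closure (WeakDual.withSeminorms (𝕜 := 𝕜) (E := X)) hs hp
  obtain ⟨x, hx⟩ := LinearMap.dualEmbedding_surjective (topDualPairing 𝕜 X) φ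
  have hx' : ∀ a, φ a = a x := fun a => (DFunLike.congr_fun hx a).symm
  exact ⟨x, u, fun a ha => hx' a ▸ h1 a ha, hx' p ▸ h2⟩

@[simp]
theorem adj_apply (T : X →L[𝕜] Y) (g : StrongDual 𝕜 Y) (x : X) : adj T g x = g (T x) :=
  rfl

/-- The second adjoint `T**` takes its values in `Y`: each `T** Φ` is the evaluation at a point of
`Y`. -/
def BidualMapsInto (T : X →L[𝕜] Y) : Prop :=
  ∀ Φ : StrongDual 𝕜 (StrongDual 𝕜 X), ∃ y : Y, ∀ g : StrongDual 𝕜 Y, Φ (adj T g) = g y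

/-- If the real parts of a functional are at most `u` on the image of the unit ball, so is the norm
of its image under the adjoint, because the unit ball is balanced. -/
theorem norm_adj_le_of_re_le {T : X →L[𝕜] Y} {g : StrongDual 𝕜 Y} {u : ℝ}
    (h : ∀ x : X, ‖x‖ ≤ 1 → RCLike.re (g (T x)) ≤ u) : ‖adj T g‖ ≤ u := by
  have hu : 0 ≤ u := by simpa using h 0 (by simp)
  refine ContinuousLinearMap.opNorm_le_of_unit_norm hu fun x hx => ?_
  obtain ⟨c, hc, hcx⟩ := RCLike.exists_norm_eq_mul_self (g (T x))
  have h1 := h (c • x) (by rw [norm_smul, hc, hx, one_mul])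
  rwa [map_smul, map_smul, smul_eq_mul, ← hcx, RCLike.ofReal_re] at h1

/-- **Goldstine's theorem**, in the form that `T**` maps the bidual unit ball into the weak-star
closure of the image of the unit ball. If the latter is relatively weakly compact, this closure
stays inside `Y`. -/
theorem IsWeaklyCompactOp.bidualMapsInto {T : X →L[𝕜] Y} (hT : IsWeaklyCompactOp T) :
    BidualMapsInto T := by
  have main : ∀ Φ : StrongDual 𝕜 (StrongDual 𝕜 X), (∀ f, ‖Φ f‖ ≤ ‖f‖) →
      ∃ y : Y, ∀ g : StrongDual 𝕜 Y, Φ (adj T g) = g y := by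
    intro Φ hΦ
    let J := NormedSpace.inclusionInDoubleDualWeak 𝕜 Y
    set S : Set (WeakSpace 𝕜 Y) := toWeakSpace 𝕜 Y '' (T '' Metric.closedBall 0 1) with hS
    let p : WeakDual 𝕜 (StrongDual 𝕜 Y) := StrongDual.toWeakDual (Φ.comp (adj T))
    have hp : p ∈ closure (J '' S) := by
      by_contra hp
      have hconv : ∀ a ∈ J '' S, ∀ b ∈ J '' S, ∀ r t : ℝ, 0 ≤ r → 0 ≤ t → r + t = 1 →
          (r : 𝕜) • a + (t : 𝕜) • b ∈ J '' S := by
        rintro _ ⟨_, ⟨_, ⟨x, hx, rfl⟩, rfl⟩, rfl⟩ _ ⟨_, ⟨_, ⟨y, hy, rfl⟩, rfl⟩, rfl⟩ r t hr ht hrt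
        simp only [Metric.mem_closedBall, dist_zero_right] at hx hy
        refine ⟨_, ⟨_, ⟨(r : 𝕜) • x + (t : 𝕜) • y, ?_, rfl⟩, rfl⟩, by simp only [map_add, map_smul]⟩
        rw [Metric.mem_closedBall, dist_zero_right, ← hrt]
        refine (norm_add_le _ _).trans ?_
        rw [norm_smul, norm_smul, RCLike.norm_ofReal, RCLike.norm_ofReal, abs_of_nonneg hr,
          abs_of_nonneg ht]
        exact add_le_add (mul_le_of_le_one_right hr hx) (mul_le_of_le_one_right ht hy)
      obtain ⟨g, u, h1, h2⟩ := exists_re_apply_lt_of_notMem_closure_weakDual hconv hp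
      have h3 : ‖adj T g‖ ≤ u := norm_adj_le_of_re_le fun x hx =>
        (h1 (J (toWeakSpace 𝕜 Y (T x)))
          ⟨_, ⟨_, ⟨x, by simpa using hx, rfl⟩, rfl⟩, rfl⟩).le
      have h4 : RCLike.re (Φ (adj T g)) ≤ u :=
        calc RCLike.re (Φ (adj T g)) ≤ ‖Φ (adj T g)‖ := RCLike.re_le_norm _
          _ ≤ ‖adj T g‖ := hΦ _
          _ ≤ u := h3
      exact absurd h2 (not_lt.2 h4)
    have hC : IsClosed (J '' closure S) := (IsCompact.image hT J.continuous).isClosed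
    obtain ⟨z, -, hz⟩ := closure_minimal (image_mono subset_closure) hC hp
    exact ⟨(toWeakSpace 𝕜 Y).symm z, fun g => (DFunLike.congr_fun hz g).symm⟩
  intro Φ
  have hpos : 0 < ‖Φ‖ + 1 := by positivity
  have hn : ((‖Φ‖ + 1 : ℝ) : 𝕜) ≠ 0 := by exact_mod_cast hpos.ne'
  obtain ⟨y, hy⟩ := main (((‖Φ‖ + 1 : ℝ) : 𝕜)⁻¹ • Φ) (fun f => by
    rw [smul_apply, norm_smul, norm_inv, RCLike.norm_ofReal, abs_of_pos hpos,
      inv_mul_le_iff₀ hpos]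
    exact (Φ.le_opNorm f).trans (by gcongr; linarith))
  refine ⟨((‖Φ‖ + 1 : ℝ) : 𝕜) • y, fun g => ?_⟩
  rw [map_smul, ← hy g, smul_apply, smul_smul, mul_inv_cancel₀ hn, one_smul]

/-- **Gantmacher's theorem**: if `T**` maps into `Y`, then `T*` is continuous from the weak-star to
the weak topology, so that Banach–Alaoglu applies. -/
theorem BidualMapsInto.isWeaklyCompact_adj {T : X →L[𝕜] Y} (hT : BidualMapsInto T) :
    IsWeaklyCompact 𝕜 (adj T '' Metric.closedBall 0 1) := by
  have hcont : Continuous fun g : WeakDual 𝕜 Y =>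
      toWeakSpace 𝕜 (StrongDual 𝕜 X) (adj T (WeakDual.toStrongDual g)) := by
    refine WeakBilin.continuous_of_continuous_eval _ fun Φ => ?_
    obtain ⟨y, hy⟩ := hT Φ
    exact (WeakDual.eval_continuous y).congr fun g => (hy g).symm
  have h := (WeakDual.isCompact_closedBall (𝕜 := 𝕜) (E := Y) 0 1).image hcont
  rw [IsWeaklyCompact]
  convert h using 1
  rw [image_image]
  rfl

/-- If `T**` maps into `Y`, then `T` is weakly compact: the weak-star compact image of the bidual
unit ball under `T**` contains the image of the unit ball under `T`. -/
theorem BidualMapsInto.isWeaklyCompactOp {T : X →L[𝕜] Y} (hT : BidualMapsInto T) :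
    IsWeaklyCompactOp T := by
  let A : WeakDual 𝕜 (StrongDual 𝕜 X) → WeakDual 𝕜 (StrongDual 𝕜 Y) := fun Φ =>
    StrongDual.toWeakDual ((WeakDual.toStrongDual Φ).comp (adj T))
  have hA : Continuous A :=
    WeakDual.continuous_of_continuous_eval fun g => WeakDual.eval_continuous (adj T g)
  have hC : IsClosed (A '' (WeakDual.toStrongDual ⁻¹' Metric.closedBall 0 1)) :=
    ((WeakDual.isCompact_closedBall (𝕜 := 𝕜) (E := StrongDual 𝕜 X) 0 1).image hA).isClosed
  refine NormedSpace.isCompact_closure_of_isBounded 𝕜 Y _ ?_ ?_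
  · rw [(toWeakSpace 𝕜 Y).injective.preimage_image]
    exact (T.lipschitz.isBounded_image Metric.isBounded_closedBall)
  · refine (closure_minimal ?_ hC).trans ?_
    · rintro _ ⟨_, ⟨_, ⟨x, hx, rfl⟩, rfl⟩, rfl⟩
      refine ⟨StrongDual.toWeakDual (NormedSpace.inclusionInDoubleDual 𝕜 X x), ?_, rfl⟩
      have := NormedSpace.double_dual_bound 𝕜 X x
      simp only [Metric.mem_closedBall, dist_zero_right] at hx
      rw [mem_preimage, Metric.mem_closedBall]
      exact (dist_zero_right (NormedSpace.inclusionInDoubleDual 𝕜 X x)).trans_le (this.trans hx)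
    · rintro _ ⟨Φ, -, rfl⟩
      obtain ⟨y, hy⟩ := hT (WeakDual.toStrongDual Φ)
      refine ⟨toWeakSpace 𝕜 Y y, ?_⟩
      exact DFunLike.ext _ _ fun g => (hy g).symm

end Gantmacher

/-! ### Absolutely convex series of a weakly null sequence -/

section Series

variable {𝕜 : Type*} [RCLike 𝕜] {E : Type*} [NormedAddCommGroup E] [NormedSpace 𝕜 E]

/-- The scalar sequences with `∑ ‖a i‖ ≤ 1`, i.e. the closed unit ball of `ℓ¹`, as a subset of the
product space. -/
def l1Ball (𝕜 : Type*) [RCLike 𝕜] : Set (ℕ → 𝕜) :=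
  {a | ∀ s : Finset ℕ, ∑ i ∈ s, ‖a i‖ ≤ 1}

theorem summable_norm_of_mem_l1Ball {a : ℕ → 𝕜} (ha : a ∈ l1Ball 𝕜) : Summable fun i => ‖a i‖ :=
  summable_of_sum_le (fun _ => norm_nonneg _) ha

theorem tsum_norm_le_of_mem_l1Ball {a : ℕ → 𝕜} (ha : a ∈ l1Ball 𝕜) : ∑' i, ‖a i‖ ≤ 1 :=
  (summable_norm_of_mem_l1Ball ha).tsum_le_of_sum_le ha

theorem isCompact_l1Ball : IsCompact (l1Ball 𝕜) := by
  have h1 : IsCompact (Set.univ.pi fun _ : ℕ => Metric.closedBall (0 : 𝕜) 1) :=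
    isCompact_univ_pi fun _ => isCompact_closedBall _ _
  refine h1.of_isClosed_subset ?_ ?_
  · rw [l1Ball, ofPred_forall]
    exact isClosed_iInter fun s => isClosed_le (by fun_prop) continuous_const
  · intro a ha i _
    simpa using ha {i}

theorem summable_smul_of_summable_norm [CompleteSpace E] {x : ℕ → E} {M : ℝ}
    (hx : ∀ n, ‖x n‖ ≤ M) {a : ℕ → 𝕜} (ha : Summable fun i => ‖a i‖) :
    Summable fun i => a i • x i := by
  refine Summable.of_norm_bounded (ha.mul_right M) fun i => ?_
  rw [norm_smul]
  gcongr
  exact hx i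

/-- Sequences in the unit ball of `ℓ¹` act on null sequences continuously for the product
topology: the tails are uniformly small. -/
theorem continuousOn_tsum_mul_l1Ball {c : ℕ → 𝕜} (hc : Tendsto c atTop (𝓝 0)) :
    ContinuousOn (fun a : ℕ → 𝕜 => ∑' i, a i * c i) (l1Ball 𝕜) := by
  obtain ⟨M, hM⟩ := hc.norm.bddAbove_range
  have hM' : ∀ n, ‖c n‖ ≤ M := fun n => hM ⟨n, rfl⟩
  refine continuousOn_of_uniform_approx_of_continuousOn fun U hU => ?_
  obtain ⟨ε, hε, hεU⟩ := Metric.mem_uniformity_dist.1 hU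
  rw [Metric.tendsto_atTop] at hc
  obtain ⟨N, hN⟩ := hc (ε / 2) (half_pos hε)
  refine ⟨fun a => ∑ i ∈ Finset.range N, a i * c i, by fun_prop, fun a ha => hεU ?_⟩
  have hsn := summable_norm_of_mem_l1Ball ha
  have hs : Summable fun i => a i * c i := by
    simpa only [smul_eq_mul] using summable_smul_of_summable_norm hM' hsn
  rw [dist_eq_norm, ← hs.sum_add_tsum_nat_add N, add_sub_cancel_left]
  have hsn' : Summable fun i => ‖a (i + N)‖ * (ε / 2) :=
    ((summable_nat_add_iff N).2 hsn).mul_right _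
  calc ‖∑' i, a (i + N) * c (i + N)‖ ≤ ∑' i, ‖a (i + N)‖ * (ε / 2) := by
        refine tsum_of_norm_bounded hsn'.hasSum fun i => ?_
        rw [norm_mul]
        gcongr
        simpa using (hN (i + N) (Nat.le_add_left _ _)).le
    _ = (∑' i, ‖a (i + N)‖) * (ε / 2) := tsum_mul_right
    _ ≤ 1 * (ε / 2) := by
        gcongr
        refine le_trans ?_ (tsum_norm_le_of_mem_l1Ball ha)
        rw [← hsn.sum_add_tsum_nat_add N]
        exact le_add_of_nonneg_left (Finset.sum_nonneg fun _ _ => norm_nonneg _)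
    _ < ε := by linarith

/-- The sums `∑ a i • x i` with `∑ ‖a i‖ ≤ 1`. -/
def l1Hull (𝕜 : Type*) [RCLike 𝕜] {E : Type*} [NormedAddCommGroup E] [NormedSpace 𝕜 E]
    (x : ℕ → E) : Set E :=
  (fun a : ℕ → 𝕜 => ∑' i, a i • x i) '' l1Ball 𝕜

theorem l1Hull_nonempty (x : ℕ → E) : (l1Hull 𝕜 x).Nonempty :=
  ⟨_, 0, fun _ => by simp, rfl⟩

/-- A special case of Krein's theorem: the closed absolutely convex hull of a weakly null sequence
is weakly compact, being the weakly continuous image of the unit ball of `ℓ¹`. -/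
theorem WeaklyTendsto.isWeaklyCompact_l1Hull [CompleteSpace E] {x : ℕ → E}
    (hx : WeaklyTendsto 𝕜 x 0) : IsWeaklyCompact 𝕜 (l1Hull 𝕜 x) := by
  obtain ⟨M, -, hM⟩ := hx.exists_norm_le
  rw [IsWeaklyCompact, l1Hull, image_image]
  refine isCompact_l1Ball.image_of_continuousOn ?_
  rw [continuousOn_iff_continuous_domRestrict]
  refine WeakBilin.continuous_of_continuous_eval _ fun f => ?_
  have hf : Tendsto (fun n => f (x n)) atTop (𝓝 0) := by simpa using weaklyTendsto_iff.1 hx f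
  refine (continuousOn_iff_continuous_domRestrict.1 (continuousOn_tsum_mul_l1Ball hf)).congr ?_
  rintro ⟨a, ha⟩
  have hs := summable_smul_of_summable_norm hM (summable_norm_of_mem_l1Ball ha)
  change ∑' i, a i * f (x i) = f (∑' i, a i • x i)
  rw [f.map_tsum hs]
  simp

end Series

/-! ### Sequence spaces in arbitrary universes and operators from `ℓ¹` -/

section Small

variable {𝕜 : Type w} [RCLike 𝕜]

theorem small_rclike : Small.{v} 𝕜 :=
  small_of_injective (β := ℝ × ℝ) (f := fun z : 𝕜 => (RCLike.re z, RCLike.im z)) fun _ _ h =>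
    RCLike.ext (congrArg Prod.fst h) (congrArg Prod.snd h)

/-- Sequence spaces over `𝕜` have isometric copies in every universe. -/
theorem exists_linearIsometryEquiv_of_injective (Z : Type w) [NormedAddCommGroup Z]
    [NormedSpace 𝕜 Z] [CompleteSpace Z] (ι : Z → ℕ → 𝕜) (hι : Function.Injective ι) :
    ∃ (Y : Type v) (_ : NormedAddCommGroup Y) (_ : NormedSpace 𝕜 Y) (_ : CompleteSpace Y),
      Nonempty (Y ≃ₗᵢ[𝕜] Z) := by
  have := small_rclike.{v} (𝕜 := 𝕜)
  have : Small.{v} Z := small_of_injective hι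
  let e : Shrink.{v} Z ≃ₗ[𝕜] Z := Shrink.linearEquiv 𝕜 Z
  let i : Shrink.{v} Z ≃ₗᵢ[𝕜] Z := ⟨e, fun _ => rfl⟩
  exact ⟨Shrink.{v} Z, inferInstance, inferInstance,
    (completeSpace_congr (e := i.toEquiv) i.isometry.isUniformEmbedding).2 inferInstance, ⟨i⟩⟩

/-- A weakly null sequence is the image of the unit vector basis under an operator from `ℓ¹` that
maps the unit ball into the absolutely convex series of the sequence. -/
theorem WeaklyTendsto.exists_l1_operator {X : Type u} [NormedAddCommGroup X] [NormedSpace 𝕜 X]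
    [CompleteSpace X] {x : ℕ → X} (hx : WeaklyTendsto 𝕜 x 0) :
    ∃ (Y : Type v) (_ : NormedAddCommGroup Y) (_ : NormedSpace 𝕜 Y) (_ : CompleteSpace Y)
      (T : Y →L[𝕜] X) (b : ℕ → Y), (∀ n, ‖b n‖ ≤ 1) ∧ (∀ n, T (b n) = x n) ∧
        T '' Metric.closedBall 0 1 ⊆ l1Hull 𝕜 x := by
  obtain ⟨M, hM0, hM⟩ := hx.exists_norm_le
  obtain ⟨Y, i1, i2, i3, ⟨i⟩⟩ := exists_linearIsometryEquiv_of_injective.{v} (𝕜 := 𝕜)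
    (lp (fun _ : ℕ => 𝕜) 1) (fun a => a) (fun a b h => lp.ext h)
  have hsum : ∀ a : lp (fun _ : ℕ => 𝕜) 1, HasSum (fun n => ‖a n‖) ‖a‖ := fun a => by
    simpa using lp.hasSum_norm (by simp) a
  have hs : ∀ a : lp (fun _ : ℕ => 𝕜) 1, Summable fun n => a n • x n := fun a =>
    summable_smul_of_summable_norm hM (hsum a).summable
  let T₀ : lp (fun _ : ℕ => 𝕜) 1 →ₗ[𝕜] X :=
    { toFun := fun a => ∑' n, a n • x n
      map_add' := fun a b => by
        rw [← (hs a).tsum_add (hs b)]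
        simp [add_smul]
      map_smul' := fun c a => by
        rw [RingHom.id_apply, ← (hs a).tsum_const_smul c]
        simp [mul_smul] }
  let T : lp (fun _ : ℕ => 𝕜) 1 →L[𝕜] X := T₀.mkContinuous M fun a => by
    have h1 := (hsum a).mul_right M
    rw [mul_comm]
    refine tsum_of_norm_bounded h1 fun n => ?_
    rw [norm_smul]
    gcongr
    exact hM n
  have hT : ∀ a, T a = ∑' n, a n • x n := fun _ => rfl
  refine ⟨Y, i1, i2, i3, T.comp (i : Y →L[𝕜] lp (fun _ : ℕ => 𝕜) 1),
    fun n => i.symm (lp.single 1 n 1), fun n => ?_, fun n => ?_, ?_⟩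
  · rw [i.symm.norm_map, lp.norm_single (by simp)]
    simp
  · have : T (lp.single 1 n 1) = x n := by
      rw [hT, tsum_eq_single n fun m hm => by simp [lp.single_apply, hm]]
      simp
    simpa using this
  · rintro _ ⟨y, hy, rfl⟩
    refine ⟨fun n => i y n, fun s => ?_, rfl⟩
    refine (sum_le_hasSum s (fun _ _ => norm_nonneg _) (hsum (i y))).trans ?_
    rw [i.norm_map]
    simpa using hy

end Small

/-! ### Operators into `c₀` -/

section CZero

variable {𝕜 : Type w} [RCLike 𝕜]

/-- The space `c₀` in an arbitrary universe, described by its coordinate functionals `π` and unit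
vectors `b`. -/
theorem exists_c0 (𝕜 : Type w) [RCLike 𝕜] :
    ∃ (Y : Type v) (_ : NormedAddCommGroup Y) (_ : NormedSpace 𝕜 Y) (_ : CompleteSpace Y)
      (π : ℕ → StrongDual 𝕜 Y) (b : ℕ → Y),
      (∀ (y : Y) (C : ℝ), 0 ≤ C → ((∀ n, ‖π n y‖ ≤ C) ↔ ‖y‖ ≤ C)) ∧
      (∀ m n, π m (b n) = if m = n then 1 else 0) ∧
      (∀ y, HasSum (fun n => π n y • b n) y) ∧
      (∀ c : ℕ → 𝕜, Tendsto c atTop (𝓝 0) → ∃ y, ∀ n, π n y = c n) := by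
  let Z := ZeroAtInftyContinuousMap ℕ 𝕜
  obtain ⟨Y, i1, i2, i3, ⟨i⟩⟩ := exists_linearIsometryEquiv_of_injective.{v} (𝕜 := 𝕜) Z
    (fun z => z) DFunLike.coe_injective
  have hcof : cocompact ℕ = atTop := by rw [cocompact_eq_cofinite, Nat.cofinite_eq_atTop]
  have hnorm : ∀ (z : Z) (C : ℝ), 0 ≤ C → ((∀ n, ‖z n‖ ≤ C) ↔ ‖z‖ ≤ C) := fun z C hC => by
    rw [← ZeroAtInftyContinuousMap.norm_toBCF_eq_norm, BoundedContinuousFunction.norm_le hC]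
    rfl
  let ev : ℕ → StrongDual 𝕜 Z := fun n =>
    LinearMap.mkContinuous
      { toFun := fun z => z n
        map_add' := fun _ _ => rfl
        map_smul' := fun _ _ => rfl } 1 fun z => by
      rw [one_mul]
      exact (hnorm z ‖z‖ (norm_nonneg z)).2 le_rfl n
  have hev : ∀ n z, ev n z = z n := fun _ _ => rfl
  have hsurj : ∀ c : ℕ → 𝕜, Tendsto c atTop (𝓝 0) → ∃ z : Z, ∀ n, z n = c n := fun c hc =>
    ⟨⟨⟨c, continuous_of_discreteTopology⟩, by
      change Tendsto c (cocompact ℕ) (𝓝 0)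
      rwa [hcof]⟩, fun _ => rfl⟩
  choose b hb using fun n => hsurj (fun m => if m = n then 1 else 0)
    (tendsto_const_nhds.congr' (eventually_atTop.2 ⟨n + 1, fun m hm => by
      exact (if_neg (by omega)).symm⟩))
  have hsum : ∀ z : Z, HasSum (fun n => z n • b n) z := by
    intro z
    have hz : Tendsto (fun n => z n) atTop (𝓝 0) := hcof ▸ z.zero_at_infty'
    rw [HasSum, SummationFilter.unconditional_filter, Metric.tendsto_atTop]
    intro ε hε
    obtain ⟨N, hN⟩ := Metric.tendsto_atTop.1 hz (ε / 2) (half_pos hε)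
    refine ⟨Finset.range N, fun s hs => lt_of_le_of_lt ?_ (half_lt_self hε)⟩
    rw [dist_eq_norm, ← hnorm _ _ (half_pos hε).le]
    intro m
    have h1 : (∑ n ∈ s, z n • b n - z) m = (if m ∈ s then z m else 0) - z m := by
      rw [← hev, map_sub, map_sum]
      simp only [map_smul]
      simp [hev, hb]
    rw [h1]
    split_ifs with hm
    · simpa using (half_pos hε).le
    · rw [zero_sub, norm_neg]
      have := hN m (by
        by_contra h
        exact hm (hs (Finset.mem_range.2 (not_le.1 h))))
      simpa using this.le
  refine ⟨Y, i1, i2, i3, fun n => (ev n).comp (i : Y →L[𝕜] Z), fun n => i.symm (b n), ?_, ?_, ?_, ?_⟩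
  · intro y C hC
    rw [← i.norm_map, ← hnorm _ _ hC]
    rfl
  · intro m n
    simp [hev, hb]
  · intro y
    have := (hsum (i y)).map i.symm i.symm.continuous
    simpa [Function.comp_def, hev] using this
  · intro c hc
    obtain ⟨z, hz⟩ := hsurj c hc
    exact ⟨i.symm z, fun n => by simp [hev, hz]⟩

/-- A weakly null sequence of functionals gives an operator `x ↦ (f n x)` into `c₀`. Its adjoint
maps the dual unit ball into the absolutely convex series of the sequence, and its second adjoint
`Φ ↦ (Φ (f n))` still takes values in `c₀` because the sequence is weakly, not just weak-star,
null. -/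
theorem WeaklyTendsto.exists_c0_operator {X : Type u} [NormedAddCommGroup X] [NormedSpace 𝕜 X]
    {f : ℕ → StrongDual 𝕜 X} (hf : WeaklyTendsto 𝕜 f 0) :
    ∃ (Y : Type v) (_ : NormedAddCommGroup Y) (_ : NormedSpace 𝕜 Y) (_ : CompleteSpace Y)
      (T : X →L[𝕜] Y) (π : ℕ → StrongDual 𝕜 Y), (∀ n, ‖π n‖ ≤ 1) ∧ (∀ n x, π n (T x) = f n x) ∧
        adj T '' Metric.closedBall 0 1 ⊆ l1Hull 𝕜 f ∧ BidualMapsInto T := by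
  obtain ⟨M, hM0, hM⟩ := hf.exists_norm_le
  obtain ⟨Y, i1, i2, i3, π, b, hnorm, hπb, hsum, hsurj⟩ := exists_c0.{v} 𝕜
  have hfΦ : ∀ Φ : StrongDual 𝕜 (StrongDual 𝕜 X), Tendsto (fun n => Φ (f n)) atTop (𝓝 0) :=
    fun Φ => by simpa using weaklyTendsto_iff.1 hf Φ
  have hπ1 : ∀ n, ‖π n‖ ≤ 1 := fun n => ContinuousLinearMap.opNorm_le_bound _ zero_le_one
    fun y => by
      rw [one_mul]
      exact (hnorm y ‖y‖ (norm_nonneg y)).2 le_rfl n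
  have hext : ∀ y z : Y, (∀ n, π n y = π n z) → y = z := fun y z h =>
    (hsum y).unique (by simpa [h] using hsum z)
  choose T₀ hT₀ using fun x : X =>
    hsurj (fun n => f n x) (hfΦ (NormedSpace.inclusionInDoubleDual 𝕜 X x))
  let T : X →L[𝕜] Y := LinearMap.mkContinuous
    { toFun := T₀
      map_add' := fun x y => hext _ _ fun n => by simp [hT₀]
      map_smul' := fun c x => hext _ _ fun n => by simp [hT₀] } M fun x => by
    refine (hnorm _ _ (by positivity)).1 fun n => ?_
    exact (congrArg norm (hT₀ x n)).trans_le ((f n).le_of_opNorm_le (hM n) x)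
  have hT : ∀ n x, π n (T x) = f n x := fun n x => hT₀ x n
  -- The functional `g` on `c₀` is represented by `(g (b n))`, whose `ℓ¹` norm is at most `‖g‖`.
  have hl1 : ∀ (g : StrongDual 𝕜 Y) (s : Finset ℕ), ∑ n ∈ s, ‖g (b n)‖ ≤ ‖g‖ := by
    intro g s
    choose c hc hcg using fun n => RCLike.exists_norm_eq_mul_self (g (b n))
    have h1 : ‖∑ n ∈ s, c n • b n‖ ≤ 1 := by
      refine (hnorm _ _ zero_le_one).1 fun m => ?_
      have : π m (∑ n ∈ s, c n • b n) = if m ∈ s then c m else 0 := by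
        simp [hπb]
      rw [this]
      split_ifs
      · exact (hc m).le
      · simp
    have h2 : g (∑ n ∈ s, c n • b n) = ((∑ n ∈ s, ‖g (b n)‖ : ℝ) : 𝕜) := by
      simp [hcg]
    have h3 := g.le_opNorm_of_le h1
    rw [h2, RCLike.norm_ofReal, mul_one] at h3
    exact (le_abs_self _).trans h3
  have hsumm : ∀ g : StrongDual 𝕜 Y, Summable fun n => g (b n) • f n := fun g =>
    summable_smul_of_summable_norm hM
      (summable_of_sum_le (fun _ => norm_nonneg _) (hl1 g))
  have hadj : ∀ g : StrongDual 𝕜 Y, adj T g = ∑' n, g (b n) • f n := by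
    intro g
    ext x
    have h1 := (hsumm g).hasSum.mapL (NormedSpace.inclusionInDoubleDual 𝕜 X x)
    have h2 := (hsum (T x)).mapL g
    refine h2.unique ?_
    simpa [hT, mul_comm] using h1
  refine ⟨Y, i1, i2, i3, T, π, hπ1, hT, ?_, fun Φ => ?_⟩
  · rintro _ ⟨g, hg, rfl⟩
    refine ⟨fun n => g (b n), fun s => (hl1 g s).trans (by simpa using hg), (hadj g).symm⟩
  · obtain ⟨y, hy⟩ := hsurj _ (hfΦ Φ)
    refine ⟨y, fun g => ?_⟩
    have h1 := (hsumm g).hasSum.mapL Φ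
    have h2 := (hsum y).mapL g
    rw [hadj g]
    refine h1.unique ?_
    simpa [hy, mul_comm] using h2

end CZero

/-! ### The equivalences -/

section Equivalences

variable {𝕜 : Type w} [RCLike 𝕜] {X : Type u} [NormedAddCommGroup X] [NormedSpace 𝕜 X]

/-- The sequential form of the Dunford–Pettis property of `X`: the evaluation pairing of `X*` and
`X` sends pairs of weakly null sequences to null sequences. -/
def SequentialDPP (𝕜 : Type w) [RCLike 𝕜] (X : Type u) [NormedAddCommGroup X] [NormedSpace 𝕜 X] :
    Prop :=
  DPPairing (ContinuousLinearMap.id 𝕜 (StrongDual 𝕜 X))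

theorem SequentialDPP.swap (h : SequentialDPP 𝕜 X) :
    DPPairing (NormedSpace.inclusionInDoubleDual 𝕜 X) :=
  fun e f he hf => h f e hf he

theorem sequentialDPP_of_swap (h : DPPairing (NormedSpace.inclusionInDoubleDual 𝕜 X)) :
    SequentialDPP 𝕜 X :=
  fun e f he hf => h f e hf he

theorem norm_inclusionInDoubleDual_apply_le (x : X) (f : StrongDual 𝕜 X) :
    ‖NormedSpace.inclusionInDoubleDual 𝕜 X x f‖ ≤ ‖x‖ * ‖f‖ :=
  (f.le_opNorm x).trans_eq (mul_comm _ _)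

theorem two_mul_ofReal (c : ℝ) : (2 : ℝ≥0∞) * ENNReal.ofReal c = ENNReal.ofReal (2 * c) := by
  rw [ENNReal.ofReal_mul zero_le_two, ENNReal.ofReal_ofNat]

theorem tendsto_zero_of_limsup_enorm_le_zero {c : ℕ → 𝕜}
    (h : limsup (fun n => ‖c n‖ₑ) atTop ≤ 0) : Tendsto c atTop (𝓝 0) := by
  rw [tendsto_zero_iff_enorm_tendsto_zero]
  exact tendsto_of_le_liminf_of_limsup_le zero_le h

/-- Weakly compact operators on a space with the sequential Dunford–Pettis property are completely
continuous: `‖T x‖` is the supremum of `|f x|` over the weakly compact image of the dual unit ball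
under `T*`. -/
theorem SequentialDPP.hasDPP (h : SequentialDPP 𝕜 X) : HasDPP.{u, v, w} 𝕜 X := by
  intro Y _ _ _ T hT x a hx
  rw [← tendsto_sub_nhds_zero_iff, Metric.tendsto_atTop]
  intro ε hε
  obtain ⟨N, hN⟩ := eventually_atTop.1
    (h.eventually_forall_norm_lt hT.bidualMapsInto.isWeaklyCompact_adj hx.sub_const hε)
  refine ⟨N, fun n hn => ?_⟩
  obtain ⟨g, hg, hgn⟩ := exists_dual_vector'' 𝕜 (T (x n - a))
  have h1 := hN n hn (adj T g) ⟨g, by simpa using hg, rfl⟩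
  rw [dist_zero_right, ← map_sub]
  have h2 : ‖g (T (x n - a))‖ = ‖T (x n - a)‖ := by rw [hgn]; simp
  rw [← h2]
  exact h1

/-- The test operator is `x ↦ (f n x)` into `c₀`, which is weakly compact. -/
theorem HasDPP.sequentialDPP (h : HasDPP.{u, v, w} 𝕜 X) : SequentialDPP 𝕜 X := by
  intro f x hf hx
  obtain ⟨Y, _, _, _, T, π, hπ, hπT, -, hT⟩ := hf.exists_c0_operator.{u, v, w}
  have h1 := h Y T hT.isWeaklyCompactOp x 0 hx
  rw [map_zero] at h1
  refine squeeze_zero_norm (fun n => ?_) (tendsto_zero_iff_norm_tendsto_zero.1 h1)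
  change ‖f n (x n)‖ ≤ _
  rw [← hπT]
  simpa using (π n).le_of_opNorm_le (hπ n) (T (x n))

/-- A bound on `cc` from a bound on oscillations, the norm being computed against functionals. -/
theorem cc_le_of_forall {Y Z : Type*} [NormedAddCommGroup Y] [NormedSpace 𝕜 Y]
    [NormedAddCommGroup Z] [NormedSpace 𝕜 Z] {T : Y →L[𝕜] Z} {t : ℝ}
    (h : ∀ y : ℕ → Y, (∀ n, ‖y n‖ ≤ 1) → IsCauchyFor (weakFamily 𝕜 Y) y →
      ∃ N : ℕ, ∀ m ≥ N, ∀ n ≥ N, ‖T (y m - y n)‖ ≤ t) : cc T ≤ ENNReal.ofReal t := by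
  refine iSup_le fun ⟨y, hy1, hy⟩ => iSup₂_le fun F hF => ?_
  obtain ⟨N, hN⟩ := h y (fun n => by simpa using hy1 n) hy
  refine (iInf_le _ N).trans (iSup₂_le fun m hm => iSup₂_le fun n hn => iSup₂_le fun g hg => ?_)
  rw [← ofReal_norm]
  refine ENNReal.ofReal_le_ofReal ?_
  have hg1 : ‖g‖ ≤ 1 := by simpa using hF hg
  rw [← map_sub]
  exact (g.le_of_opNorm_le hg1 _).trans ((one_mul _).trans_le (hN m hm n hn))

/-- If `cc T = 0`, then `T` sends weakly null sequences in the unit ball to null sequences; this is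
stated after testing against functionals in the unit ball, which may vary with the index. -/
theorem tendsto_zero_of_cc_eq_zero {Y Z : Type*} [NormedAddCommGroup Y] [NormedSpace 𝕜 Y]
    [NormedAddCommGroup Z] [NormedSpace 𝕜 Z] {T : Y →L[𝕜] Z} (h : cc T ≤ 0) {y : ℕ → Y}
    (hy1 : ∀ n, ‖y n‖ ≤ 1) (hy : WeaklyTendsto 𝕜 y 0) {g : ℕ → StrongDual 𝕜 Z}
    (hg : ∀ n, ‖g n‖ ≤ 1) : Tendsto (fun n => g n (T (y n))) atTop (𝓝 0) := by
  have h1 : ca (normFamily 𝕜 Z) (fun k => T (y k)) ≤ 0 :=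
    (le_iSup (fun y : {y : ℕ → Y // (∀ k, y k ∈ Metric.closedBall (0 : Y) 1) ∧
      IsCauchyFor (weakFamily 𝕜 Y) y} => ca (normFamily 𝕜 Z) (fun k => T (y.1 k)))
      ⟨y, fun n => by simpa using hy1 n, hy.isCauchyFor⟩).trans h
  have h2 : (⨅ N : ℕ, ⨆ m ≥ N, ⨆ n ≥ N, qSeminorm (range g) (T (y m) - T (y n))) ≤ 0 :=
    (le_iSup₂ (f := fun F (_ : F ∈ normFamily 𝕜 Z) =>
      ⨅ N : ℕ, ⨆ m ≥ N, ⨆ n ≥ N, qSeminorm F (T (y m) - T (y n))) (range g) (by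
        rintro _ ⟨n, rfl⟩
        simpa using hg n)).trans h1
  rw [Metric.tendsto_atTop]
  intro ε hε
  obtain ⟨N, hN⟩ := iInf_lt_iff.1 (h2.trans_lt (ENNReal.ofReal_pos.2 (half_pos hε)))
  refine ⟨N, fun n hn => ?_⟩
  have h3 : ∀ m ≥ N, ‖g n (T (y m) - T (y n))‖ ≤ ε / 2 := by
    intro m hm
    rw [← ENNReal.ofReal_le_ofReal_iff (half_pos hε).le, ofReal_norm]
    refine le_trans ?_ hN.le
    refine le_trans ?_ (le_iSup₂ (f := fun m (_ : m ≥ N) => ⨆ n ≥ N, qSeminorm (range g)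
      (T (y m) - T (y n))) m hm)
    refine le_trans ?_ (le_iSup₂ (f := fun n (_ : n ≥ N) => qSeminorm (range g)
      (T (y m) - T (y n))) n hn)
    exact le_iSup₂ (f := fun φ (_ : φ ∈ range g) => ‖φ (T (y m) - T (y n))‖ₑ) (g n) ⟨n, rfl⟩
  have h4 : Tendsto (fun m => ‖g n (T (y m) - T (y n))‖) atTop (𝓝 ‖0 - g n (T (y n))‖) := by
    have := weaklyTendsto_iff.1 hy ((g n).comp T)
    simp only [map_sub]
    refine (Tendsto.sub_const ?_ _).norm
    simpa using this
  have h5 := le_of_tendsto h4 (eventually_atTop.2 ⟨N, h3⟩)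
  rw [zero_sub, norm_neg] at h5
  rw [dist_zero_right]
  linarith

theorem SequentialDPP.cc_le_opDeBlasi_adj (h : SequentialDPP 𝕜 X) {Y : Type*}
    [NormedAddCommGroup Y] [NormedSpace 𝕜 Y] (T : X →L[𝕜] Y) :
    cc T ≤ 2 * opDeBlasi (adj T) := by
  refine le_mul_deBlasi two_ne_zero ENNReal.ofNat_ne_top fun K c' c hK h0 hc hA => ?_
  rw [two_mul_ofReal]
  refine cc_le_of_forall fun x hx1 hx => ?_
  obtain ⟨N, hN⟩ := h.exists_forall_norm_sub_le (fun f x => f.le_opNorm x) hK h0 hc hA hx hx1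
  refine ⟨N, fun m hm n hn => ?_⟩
  obtain ⟨g, hg, hgn⟩ := exists_dual_vector'' 𝕜 (T (x m - x n))
  have h2 : ‖g (T (x m - x n))‖ = ‖T (x m - x n)‖ := by rw [hgn]; simp
  rw [← h2]
  exact hN m hm n hn (adj T g) ⟨g, by simpa using hg, rfl⟩

theorem SequentialDPP.cc_adj_le_opDeBlasi (h : SequentialDPP 𝕜 X) {Y : Type*}
    [NormedAddCommGroup Y] [NormedSpace 𝕜 Y] (T : Y →L[𝕜] X) :
    cc (adj T) ≤ 2 * opDeBlasi T := by
  refine le_mul_deBlasi two_ne_zero ENNReal.ofNat_ne_top fun K c' c hK h0 hc hA => ?_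
  rw [two_mul_ofReal]
  refine cc_le_of_forall fun f hf1 hf => ?_
  obtain ⟨N, hN⟩ := h.swap.exists_forall_norm_sub_le norm_inclusionInDoubleDual_apply_le hK h0 hc
    hA hf hf1
  refine ⟨N, fun m hm n hn => ?_⟩
  exact ContinuousLinearMap.opNorm_le_of_unit_norm (by linarith) fun y hy =>
    hN m hm n hn (T y) ⟨y, by simp [hy], rfl⟩

theorem sequentialDPP_of_cc_le_opDeBlasi_adj
    (h : ∀ (Y : Type v) [NormedAddCommGroup Y] [NormedSpace 𝕜 Y] [CompleteSpace Y] (T : X →L[𝕜] Y),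
      cc T ≤ 2 * opDeBlasi (adj T)) : SequentialDPP 𝕜 X := by
  refine DPPairing.of_norm_le_one fun f x hf hx hx1 => ?_
  obtain ⟨Y, _, _, _, T, π, hπ, hπT, hT, -⟩ := hf.exists_c0_operator.{u, v, w}
  have h0 : cc T ≤ 0 := by
    have := h Y T
    rwa [opDeBlasi, deBlasi_eq_zero_of_subset hf.isWeaklyCompact_l1Hull (l1Hull_nonempty f) hT,
      mul_zero] at this
  simpa [hπT] using tendsto_zero_of_cc_eq_zero h0 hx1 hx hπ

theorem sequentialDPP_of_cc_adj_le_opDeBlasi [CompleteSpace X]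
    (h : ∀ (Y : Type v) [NormedAddCommGroup Y] [NormedSpace 𝕜 Y] [CompleteSpace Y] (T : Y →L[𝕜] X),
      cc (adj T) ≤ 2 * opDeBlasi T) : SequentialDPP 𝕜 X := by
  refine sequentialDPP_of_swap (DPPairing.of_norm_le_one fun x f hx hf hf1 => ?_)
  obtain ⟨Y, _, _, _, T, b, hb, hbT, hT⟩ := hx.exists_l1_operator.{u, v, w}
  have h0 : cc (adj T) ≤ 0 := by
    have := h Y T
    rwa [opDeBlasi, deBlasi_eq_zero_of_subset hx.isWeaklyCompact_l1Hull (l1Hull_nonempty x) hT,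
      mul_zero] at this
  have hb' : ∀ n, ‖NormedSpace.inclusionInDoubleDual 𝕜 Y (b n)‖ ≤ 1 := fun n =>
    (NormedSpace.double_dual_bound 𝕜 Y (b n)).trans (hb n)
  simpa [hbT] using tendsto_zero_of_cc_eq_zero h0 hf1 hf hb'

/-- A bound on `wca` from a bound on the oscillation of a subsequence. -/
theorem wca_le_of_subseq {E : Type*} [NormedAddCommGroup E] [NormedSpace 𝕜 E]
    {𝓕 : Set (Set (StrongDual 𝕜 E))} {e : ℕ → E} {t : ℝ} {φ : ℕ → ℕ} (hφ : StrictMono φ)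
    (h : ∀ F ∈ 𝓕, ∃ N : ℕ, ∀ m ≥ N, ∀ n ≥ N, ∀ g ∈ F, ‖g (e (φ m) - e (φ n))‖ ≤ t) :
    wca 𝓕 e ≤ ENNReal.ofReal t := by
  refine (iInf_le _ ⟨φ, hφ⟩).trans (iSup₂_le fun F hF => ?_)
  obtain ⟨N, hN⟩ := h F hF
  refine (iInf_le _ N).trans (iSup₂_le fun m hm => iSup₂_le fun n hn => iSup₂_le fun g hg => ?_)
  rw [← ofReal_norm]
  exact ENNReal.ofReal_le_ofReal (hN m hm n hn g hg)

theorem exists_subseq_of_wca_lt {E : Type*} [NormedAddCommGroup E] [NormedSpace 𝕜 E]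
    {𝓕 : Set (Set (StrongDual 𝕜 E))} {e : ℕ → E} {t : ℝ} (ht : 0 ≤ t)
    (h : wca 𝓕 e < ENNReal.ofReal t) : ∃ φ : ℕ → ℕ, StrictMono φ ∧
      ∀ F ∈ 𝓕, ∃ N : ℕ, ∀ m ≥ N, ∀ n ≥ N, ∀ g ∈ F, ‖g (e (φ m) - e (φ n))‖ ≤ t := by
  obtain ⟨⟨φ, hφ⟩, hca⟩ := iInf_lt_iff.1 h
  refine ⟨φ, hφ, fun F hF => ?_⟩
  obtain ⟨N, hN⟩ := iInf_lt_iff.1 ((le_iSup₂ (f := fun F (_ : F ∈ 𝓕) =>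
    ⨅ N : ℕ, ⨆ m ≥ N, ⨆ n ≥ N, qSeminorm F ((e ∘ φ) m - (e ∘ φ) n)) F hF).trans_lt hca)
  refine ⟨N, fun m hm n hn g hg => ?_⟩
  rw [← ENNReal.ofReal_le_ofReal_iff ht, ofReal_norm]
  refine le_trans ?_ hN.le
  refine le_trans ?_ (le_iSup₂ (f := fun m (_ : m ≥ N) => ⨆ n ≥ N, qSeminorm F
    ((e ∘ φ) m - (e ∘ φ) n)) m hm)
  refine le_trans ?_ (le_iSup₂ (f := fun n (_ : n ≥ N) => qSeminorm F
    ((e ∘ φ) m - (e ∘ φ) n)) n hn)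
  exact le_iSup₂ (f := fun φ' (_ : φ' ∈ F) => ‖φ' ((e ∘ φ) m - (e ∘ φ) n)‖ₑ) g hg

theorem SequentialDPP.wca_rhoStar_le (h : SequentialDPP 𝕜 X) (f : ℕ → StrongDual 𝕜 X) :
    wca (rhoStarFamily 𝕜 X) f ≤ 2 * deBlasi 𝕜 (range f) := by
  refine le_mul_deBlasi two_ne_zero ENNReal.ofNat_ne_top fun K c' c hK h0 hc hA => ?_
  rw [two_mul_ofReal]
  obtain ⟨φ, hφ, hL⟩ := h.exists_subseq_forall_norm_sub_le (fun f x => f.le_opNorm x) hK h0 hc hA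
  refine wca_le_of_subseq hφ ?_
  rintro _ ⟨L, hL1, hLc, rfl⟩
  obtain ⟨N, hN⟩ := hL L hL1 hLc
  refine ⟨N, fun m hm n hn => ?_⟩
  rintro _ ⟨l, hl, rfl⟩
  exact hN m hm n hn l hl

theorem SequentialDPP.wca_rho_le (h : SequentialDPP 𝕜 X) (x : ℕ → X) :
    wca (rhoFamily 𝕜 X) x ≤ 2 * deBlasi 𝕜 (range x) := by
  refine le_mul_deBlasi two_ne_zero ENNReal.ofNat_ne_top fun K c' c hK h0 hc hA => ?_
  rw [two_mul_ofReal]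
  obtain ⟨φ, hφ, hL⟩ := h.swap.exists_subseq_forall_norm_sub_le
    norm_inclusionInDoubleDual_apply_le hK h0 hc hA
  exact wca_le_of_subseq hφ fun L hLF => hL L hLF.1 hLF.2

theorem WeaklyTendsto.isBounded_range {E : Type*} [NormedAddCommGroup E] [NormedSpace 𝕜 E]
    {x : ℕ → E} {a : E} (h : WeaklyTendsto 𝕜 x a) : Bornology.IsBounded (range x) := by
  obtain ⟨M, -, hM⟩ := h.exists_norm_le
  exact isBounded_iff_forall_norm_le.2 ⟨M, by rintro _ ⟨n, rfl⟩; exact hM n⟩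

theorem sequentialDPP_of_wca_rhoStar_le
    (h : ∀ f : ℕ → StrongDual 𝕜 X, Bornology.IsBounded (range f) →
      wca (rhoStarFamily 𝕜 X) f ≤ 2 * deBlasi 𝕜 (range f)) : SequentialDPP 𝕜 X := by
  refine DPPairing.of_exists_subseq fun f ε hf hε => ?_
  have h0 := h f hf.isBounded_range
  rw [hf.deBlasi_range, mul_zero] at h0
  obtain ⟨φ, hφ, hL⟩ := exists_subseq_of_wca_lt hε.le (h0.trans_lt (ENNReal.ofReal_pos.2 hε))
  refine ⟨φ, hφ, fun L hL1 hLc => ?_⟩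
  obtain ⟨N, hN⟩ := hL _ ⟨L, hL1, hLc, rfl⟩
  exact ⟨N, fun m hm n hn l hl => hN m hm n hn _ ⟨l, hl, rfl⟩⟩

theorem sequentialDPP_of_wca_rho_le
    (h : ∀ x : ℕ → X, Bornology.IsBounded (range x) →
      wca (rhoFamily 𝕜 X) x ≤ 2 * deBlasi 𝕜 (range x)) : SequentialDPP 𝕜 X := by
  refine sequentialDPP_of_swap (DPPairing.of_exists_subseq fun x ε hx hε => ?_)
  have h0 := h x hx.isBounded_range
  rw [hx.deBlasi_range, mul_zero] at h0
  obtain ⟨φ, hφ, hL⟩ := exists_subseq_of_wca_lt hε.le (h0.trans_lt (ENNReal.ofReal_pos.2 hε))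
  exact ⟨φ, hφ, fun L hL1 hLc => hL L ⟨hL1, hLc⟩⟩

end Equivalences

end QuantDP

theorem theorem4p2 (𝕜 : Type w) [RCLike 𝕜]
    (X : Type u) [NormedAddCommGroup X] [NormedSpace 𝕜 X] [CompleteSpace X] :
    List.TFAE [
      -- (i)
      QuantDP.HasDPP.{u, v, w} 𝕜 X,
      -- (ii)
      ∀ (Y : Type v) [NormedAddCommGroup Y] [NormedSpace 𝕜 Y] [CompleteSpace Y] (T : X →L[𝕜] Y),
        QuantDP.cc T ≤ 2 * QuantDP.opDeBlasi (QuantDP.adj T),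
      -- (iii)
      ∀ (Y : Type v) [NormedAddCommGroup Y] [NormedSpace 𝕜 Y] [CompleteSpace Y] (T : Y →L[𝕜] X),
        QuantDP.cc (QuantDP.adj T) ≤ 2 * QuantDP.opDeBlasi T,
      -- (iv)
      ∀ (x : ℕ → X) (f : ℕ → StrongDual 𝕜 X),
        (∀ n, x n ∈ Metric.closedBall (0 : X) 1) → QuantDP.WeaklyTendsto 𝕜 x 0 →
        Bornology.IsBounded (Set.range f) →
        Filter.limsup (fun n => ‖f n (x n)‖ₑ) Filter.atTop ≤ QuantDP.deBlasi 𝕜 (Set.range f),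
      -- (v)
      ∀ (x : ℕ → X) (f : ℕ → StrongDual 𝕜 X),
        Bornology.IsBounded (Set.range x) →
        (∀ n, f n ∈ Metric.closedBall (0 : StrongDual 𝕜 X) 1) → QuantDP.WeaklyTendsto 𝕜 f 0 →
        Filter.limsup (fun n => ‖f n (x n)‖ₑ) Filter.atTop ≤ QuantDP.deBlasi 𝕜 (Set.range x),
      -- (vi)
      ∀ f : ℕ → StrongDual 𝕜 X, Bornology.IsBounded (Set.range f) →
        QuantDP.wca (QuantDP.rhoStarFamily 𝕜 X) f ≤ 2 * QuantDP.deBlasi 𝕜 (Set.range f),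
      -- (vii)
      ∀ x : ℕ → X, Bornology.IsBounded (Set.range x) →
        QuantDP.wca (QuantDP.rhoFamily 𝕜 X) x ≤ 2 * QuantDP.deBlasi 𝕜 (Set.range x)] := by
  have hi : QuantDP.HasDPP.{u, v, w} 𝕜 X ↔ QuantDP.SequentialDPP 𝕜 X :=
    ⟨fun h => h.sequentialDPP, fun h => h.hasDPP⟩
  -- Every assertion is equivalent to the sequential Dunford–Pettis property.
  refine List.tfae_of_forall (QuantDP.SequentialDPP 𝕜 X) _ ?_
  simp only [List.forall_mem_cons, List.not_mem_nil, IsEmpty.forall_iff, implies_true, and_true]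
  refine ⟨hi, ⟨QuantDP.sequentialDPP_of_cc_le_opDeBlasi_adj,
      fun h Y _ _ _ T => h.cc_le_opDeBlasi_adj T⟩,
    ⟨QuantDP.sequentialDPP_of_cc_adj_le_opDeBlasi, fun h Y _ _ _ T => h.cc_adj_le_opDeBlasi T⟩,
    ⟨fun h => ?_, fun h x f hx1 hx _ => ?_⟩, ⟨fun h => ?_, fun h x f _ hf1 hf => ?_⟩,
    ⟨QuantDP.sequentialDPP_of_wca_rhoStar_le, fun h f _ => h.wca_rhoStar_le f⟩,
    ⟨QuantDP.sequentialDPP_of_wca_rho_le, fun h x _ => h.wca_rho_le x⟩⟩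
  · refine QuantDP.DPPairing.of_norm_le_one fun f x hf hx hx1 => ?_
    refine QuantDP.tendsto_zero_of_limsup_enorm_le_zero ?_
    have := h x f (fun n => by simpa using hx1 n) hx hf.isBounded_range
    rwa [hf.deBlasi_range] at this
  · exact QuantDP.DPPairing.limsup_le_deBlasi h (fun f x => f.le_opNorm x) f hx
      fun n => by simpa using hx1 n
  · refine QuantDP.sequentialDPP_of_swap
      (QuantDP.DPPairing.of_norm_le_one fun x f hx hf hf1 => ?_)
    refine QuantDP.tendsto_zero_of_limsup_enorm_le_zero ?_
    have := h x f hx.isBounded_range (fun n => by simpa using hf1 n) hf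
    rwa [hx.deBlasi_range] at this
  · exact h.swap.limsup_le_deBlasi QuantDP.norm_inclusionInDoubleDual_apply_le x hf
      fun n => by simpa using hf1 n
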